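/- Let $\kappa$ be an uncountable cardinal. The axiom $\operatorname{Slice}_\kappa$ says that there is a sequence $\langle M_\alpha \mid \alpha<\kappa\rangle$ of transitive classes (sets or proper classes) such that (1) $M_\alpha\models \mathrm{ZFC}$ for every $\alpha<\kappa$; (2) $\omega_1^{M_\alpha}=\omega_1$ for every $\alpha<\kappa$; (3) $2^{\delta}=\bigcup_{\alpha<\kappa}\bigl(2^{\delta}\cap M_\alpha\bigr)$ for every ordinal $\delta\in[\omega,\kappa)$, where $2^\delta$ is the set of all functions from $\delta$ to $\{0,1\}$; (4) $2^{\delta}\cap M_\alpha\subsetneq 2^{\delta}\cap M_\beta$ for all $\alpha<\beta<\kappa$ and every ordinal $\delta\in[\omega,\kappa)$. A set $X\subseteq\mathbb R$ is called $\omega_1$-dense if $|X\cap(a,b)|=\aleph_1$ for all reals $a<b$, and rigid if the identity is the only order-automorphism of $(X,<)$. **Theorem.** If $\operatorname{Slice}_{\omega_1}$ holds, then there is a set $X\subseteq\mathbb R$ that is $\omega_1$-dense and rigid. -/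

import Mathlib

universe u

open scoped Cardinal Ordinal

namespace Slicing

open FirstOrder FirstOrder.Language

/-! ## The first-order language of set theory and the theory ZFC -/

/-- The only symbol of the language of set theory is the binary relation symbol for membership. -/
inductive MemRel : ℕ → Type
  | mem : MemRel 2

/-- The first-order language of set theory. -/
def setLang : FirstOrder.Language.{0, 0} := ⟨fun _ => Empty, MemRel⟩

/-- Formulas of set theory whose free variables are `0, …, n - 1`. The variable bound by a
quantifier in front of a member of `Fm (n + 1)` is `Fin.last n`; an older variable `i : Fin n` is
written `i.castSucc` below that quantifier. -/
abbrev Fm (n : ℕ) : Type := setLang.BoundedFormula Empty n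

variable {n : ℕ}

/-- `x ∈ y`. -/
def fMem (x y : Fin n) : Fm n :=
  Relations.boundedFormula₂ (L := setLang) MemRel.mem (Term.var (Sum.inr x)) (Term.var (Sum.inr y))

/-- `x = y`. -/
def fEq (x y : Fin n) : Fm n :=
  Term.bdEqual (Term.var (Sum.inr x)) (Term.var (Sum.inr y))

/-- `∀ z, F z`. -/
def fAll (F : Fin (n + 1) → Fm (n + 1)) : Fm n := (F (Fin.last n)).all

/-- `∃ z, F z`. -/
def fEx (F : Fin (n + 1) → Fm (n + 1)) : Fm n := (F (Fin.last n)).ex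

/-- `∀ z ∈ x, F z`. -/
def fAllMem (x : Fin n) (F : Fin (n + 1) → Fm (n + 1)) : Fm n :=
  fAll fun z => (fMem z x.castSucc).imp (F z)

/-- `∃ z ∈ x, F z`. -/
def fExMem (x : Fin n) (F : Fin (n + 1) → Fm (n + 1)) : Fm n :=
  fEx fun z => fMem z x.castSucc ⊓ F z

/-- `x ⊆ y`. -/
def fSubset (x y : Fin n) : Fm n := fAllMem x fun z => fMem z y.castSucc

/-- `x = ∅`. -/
def fEmpty (x : Fin n) : Fm n := fAll fun z => (fMem z x.castSucc).not

/-- `s = x ∪ {x}`. -/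
def fSucc (s x : Fin n) : Fm n :=
  fAll fun z => (fMem z s.castSucc).iff (fMem z x.castSucc ⊔ fEq z x.castSucc)

/-- `w` is an inductive set: `∅ ∈ w`, and `y ∪ {y} ∈ w` for all `y ∈ w`. -/
def fInductive (w : Fin n) : Fm n :=
  (fExMem w fun e => fEmpty e) ⊓
    (fAllMem w fun y => fExMem w.castSucc fun s => fSucc s y.castSucc)

/-- `p = {x, y}`. -/
def fUPair (p x y : Fin n) : Fm n :=
  fAll fun z => (fMem z p.castSucc).iff (fEq z x.castSucc ⊔ fEq z y.castSucc)

/-- The axiom of extensionality. -/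
def axExt : setLang.Sentence :=
  fAll (n := 0) fun x => fAll fun y =>
    (fAll fun z => (fMem z x.castSucc.castSucc).iff (fMem z y.castSucc)).imp (fEq x.castSucc y)

/-- The axiom of foundation: each nonempty set has a member that is disjoint from it. -/
def axFoundation : setLang.Sentence :=
  fAll (n := 0) fun x =>
    (fEmpty x).not.imp
      (fExMem x fun y => fAllMem y fun z => (fMem z x.castSucc.castSucc).not)

/-- The axiom of pairing. -/
def axPairing : setLang.Sentence :=
  fAll (n := 0) fun x => fAll fun y => fEx fun p => fUPair p x.castSucc.castSucc y.castSucc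

/-- The axiom of union. -/
def axUnion : setLang.Sentence :=
  fAll (n := 0) fun x => fEx fun v => fAll fun z =>
    (fMem z v.castSucc).iff (fExMem x.castSucc.castSucc fun y => fMem z.castSucc y)

/-- The axiom of power set. -/
def axPower : setLang.Sentence :=
  fAll (n := 0) fun x => fEx fun p => fAll fun z =>
    (fMem z p.castSucc).iff (fSubset z x.castSucc.castSucc)

/-- The axiom of infinity. -/
def axInfinity : setLang.Sentence := fEx (n := 0) fun w => fInductive w

/-- The axiom of choice: each family of nonempty pairwise disjoint sets has a transversal. -/
def axChoice : setLang.Sentence :=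
  fAll (n := 0) fun a =>
    ((fAllMem a fun x => (fEmpty x).not) ⊓
      (fAllMem a fun x => fAllMem a.castSucc fun y =>
        (fEx fun z => fMem z x.castSucc.castSucc ⊓ fMem z y.castSucc).imp
          (fEq x.castSucc y))).imp
      (fEx fun c => fAllMem a.castSucc fun x =>
        fExMem x fun y => fMem y c.castSucc.castSucc ⊓
          (fAllMem x.castSucc fun z =>
            (fMem z c.castSucc.castSucc.castSucc).imp (fEq z y.castSucc)))

/-- The formula `φ(p, t)`, where `p` consists of the first `n` of the `n + m` available variables
and `t` is a `k`-tuple of variables. -/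
def fInst {n m k : ℕ} (φ : setLang.Formula (Fin n ⊕ Fin k)) (t : Fin k → Fin (n + m)) :
    Fm (n + m) :=
  BoundedFormula.relabel (n := n + m) (k := 0)
    (Sum.elim (fun i => Sum.inr (Fin.castAdd m i)) fun j => Sum.inr (t j)) φ

/-- The instance of the separation schema for the formula `φ(p, z)` with `n` parameters `p`:
`∀ p, ∀ a, ∃ b, ∀ z, (z ∈ b ↔ z ∈ a ∧ φ(p, z))`. -/
def axSeparation (n : ℕ) (φ : setLang.Formula (Fin n ⊕ Fin 1)) : setLang.Sentence :=
  BoundedFormula.alls (n := n) <|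
    fAll fun a => fEx fun b => fAll fun z =>
      (fMem z b.castSucc).iff
        (fMem z a.castSucc.castSucc ⊓ fInst (n := n) (m := 3) φ ![z])

/-- The instance of the replacement schema for the formula `φ(p, x, y)` with `n` parameters `p`:
`∀ p, ∀ a, (∀ x ∈ a, ∃! y, φ(p, x, y)) → ∃ b, ∀ y, (y ∈ b ↔ ∃ x ∈ a, φ(p, x, y))`. -/
def axReplacement (n : ℕ) (φ : setLang.Formula (Fin n ⊕ Fin 2)) : setLang.Sentence :=
  BoundedFormula.alls (n := n) <|
    fAll fun a =>
      (fAllMem a fun x => fEx fun y =>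
        fInst (n := n) (m := 3) φ ![x.castSucc, y] ⊓
          (fAll fun y' =>
            (fInst (n := n) (m := 4) φ ![x.castSucc.castSucc, y']).imp (fEq y' y.castSucc))).imp
      (fEx fun b => fAll fun y =>
        (fMem y b.castSucc).iff
          (fExMem a.castSucc.castSucc fun x =>
            fInst (n := n) (m := 4) φ ![x, y.castSucc]))

/-- Zermelo–Fraenkel set theory with choice. -/
def ZFC : setLang.Theory :=
  {axExt, axFoundation, axPairing, axUnion, axPower, axInfinity, axChoice} ∪
    {σ | ∃ n φ, σ = axSeparation n φ} ∪ {σ | ∃ n φ, σ = axReplacement n φ}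

/-! ## The formula defining the first uncountable ordinal -/

/-- `p` is the Kuratowski ordered pair `(x, y) = {{x}, {x, y}}`. -/
def fOPair (p x y : Fin n) : Fm n :=
  fEx fun s => fEx fun d =>
    fUPair s.castSucc x.castSucc.castSucc x.castSucc.castSucc ⊓
      (fUPair d x.castSucc.castSucc y.castSucc.castSucc ⊓
        fUPair p.castSucc.castSucc s.castSucc d)

/-- `(x, y) ∈ f`. -/
def fPairMem (f x y : Fin n) : Fm n :=
  fExMem f fun p => fOPair p x.castSucc y.castSucc

/-- `f` is an injective function from `x` to `w`. -/
def fInjection (f x w : Fin n) : Fm n :=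
  (fAllMem f fun p => fExMem x.castSucc fun a => fExMem w.castSucc.castSucc fun b =>
      fOPair p.castSucc.castSucc a.castSucc b) ⊓
    ((fAllMem x fun a => fEx fun b => fPairMem f.castSucc.castSucc a.castSucc b) ⊓
      ((fAll fun a => fAll fun b => fAll fun b' =>
        (fPairMem f.castSucc.castSucc.castSucc a.castSucc.castSucc b.castSucc ⊓
          fPairMem f.castSucc.castSucc.castSucc a.castSucc.castSucc b').imp
            (fEq b.castSucc b')) ⊓
      (fAll fun a => fAll fun a' => fAll fun b =>
        (fPairMem f.castSucc.castSucc.castSucc a.castSucc.castSucc b ⊓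
          fPairMem f.castSucc.castSucc.castSucc a'.castSucc b).imp
            (fEq a.castSucc.castSucc a'.castSucc))))

/-- `w = ω`, the least inductive set. -/
def fOmega (w : Fin n) : Fm n :=
  fInductive w ⊓ fAll fun v => (fInductive v).imp (fSubset w.castSucc v)

/-- `x` is countable: it has an injection into `ω`. -/
def fCountable (x : Fin n) : Fm n :=
  fEx fun w => fOmega w ⊓ fEx fun f => fInjection f x.castSucc.castSucc w.castSucc

/-- `x` is a transitive set. -/
def fTransitive (x : Fin n) : Fm n := fAllMem x fun y => fSubset y x.castSucc

/-- `x` is an ordinal: a transitive set of transitive sets. -/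
def fOrdinal (x : Fin n) : Fm n := fTransitive x ⊓ fAllMem x fun y => fTransitive y

/-- `x = ω₁`: `x` is the least uncountable ordinal. -/
def fOmegaOne (x : Fin n) : Fm n :=
  fOrdinal x ⊓ ((fCountable x).not ⊓ fAllMem x fun y => fCountable y)

/-! ## Transitive classes and the slicing axioms -/

/-- A class of sets, with the true membership relation, as a structure for the language of set
theory. -/
instance classStructure (M : Set ZFSet.{u}) : setLang.Structure M where
  funMap := fun f _ => Empty.elim f
  RelMap := fun r => match r with
    | MemRel.mem => fun v => (v 0 : ZFSet.{u}) ∈ (v 1 : ZFSet.{u})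

/-- `M` is a transitive class (a set or a proper class). -/
def TransitiveClass (M : Set ZFSet.{u}) : Prop := ∀ x ∈ M, ∀ y ∈ x, y ∈ M

/-- `ω₁ ^ M = ω₁`: the true `ω₁` belongs to `M`, and `M` satisfies that it is the least uncountable
ordinal. -/
def CorrectOmegaOne (M : Set ZFSet.{u}) : Prop :=
  ∃ h : (ω_ 1 : Ordinal.{u}).toZFSet ∈ M,
    (fOmegaOne (n := 1) 0).Realize (M := M) Empty.elim ![⟨(ω_ 1 : Ordinal.{u}).toZFSet, h⟩]

/-- The set `2 ^ δ` of all functions from the ordinal `δ` to `2 = {0, 1}`. -/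
noncomputable def twoPow (δ : Ordinal.{u}) : ZFSet.{u} :=
  ZFSet.funs δ.toZFSet (2 : Ordinal.{u}).toZFSet

/-- The axiom `Slice_κ`, for an uncountable cardinal `κ`. Only the terms `M α` with `α < κ` of the
sequence matter. -/
def Slice (κ : Cardinal.{u}) : Prop :=
  ∃ M : Ordinal.{u} → Set ZFSet.{u},
    (∀ α < κ.ord, TransitiveClass (M α)) ∧
    (∀ α < κ.ord, M α ⊨ ZFC) ∧
    (∀ α < κ.ord, CorrectOmegaOne (M α)) ∧
    (∀ δ : Ordinal.{u}, ω ≤ δ → δ < κ.ord →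
      (twoPow δ : Set ZFSet.{u}) = ⋃ α ∈ Set.Iio κ.ord, (twoPow δ : Set ZFSet.{u}) ∩ M α) ∧
    (∀ α β : Ordinal.{u}, α < β → β < κ.ord → ∀ δ : Ordinal.{u}, ω ≤ δ → δ < κ.ord →
      (twoPow δ : Set ZFSet.{u}) ∩ M α ⊂ (twoPow δ : Set ZFSet.{u}) ∩ M β)

/-! ## Sets of reals -/

/-- A set of reals is `ω₁`-dense if it has exactly `ℵ₁` elements in each nonempty open interval of
the real line. -/
def OmegaOneDense (X : Set ℝ) : Prop :=
  ∀ a b : ℝ, a < b → #(X ∩ Set.Ioo a b : Set ℝ) = ℵ₁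

/-- A set of reals is rigid if the identity is its only order-automorphism. -/
def Rigid (X : Set ℝ) : Prop := ∀ f : X ≃o X, f = OrderIso.refl X

end Slicing

/-!
For `α < ω₁` let `A α` be the collection of all `S ⊆ ℕ` whose characteristic function belongs to
`M α`. Slicing at `δ = ω` makes `A` strictly increasing with union the power set of `ℕ`. Say that a
real number belongs to stage `α` if its Dedekind cut, as a set of rationals coded by a subset of
`ℕ`, is in `A α`. At each late stage `α` a real number `x α` is chosen that belongs to stage
`α + 1` but not to stage `α`, in such a way that each rational interval is aimed at `ℵ₁` times; the
set `X` consists of these real numbers. A late stage does have new reals in all intervals: a subset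
of `ℕ` and the cut of the corresponding point of the Cantor set are arithmetical in each other
(`Filtration.coded_cut_cantorPoint_iff`), and rational translations do not change the stage
(`Filtration.exists_new_real`).

The set `X` is rigid (`Filtration.rigid_range`). An order-automorphism `f` of `X` is determined by a
relation between rationals which computes the cut of `f x` from the cut of `x`
(`Filtration.coded_cut_orderIso`). This relation is a countable object, so it is coded at some
stage `α`, and the same holds for the inverse of `f`. Hence `f` and its inverse preserve
each stage `β ≥ α`, so `f` maps `x β`, the only point of `X` that appears at stage `β + 1`, to
itself. The points `x β` with `β ≥ α` are dense, so `f` is the identity.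

What is needed of the models `M α` is that `A α` is closed under complements, intersections and
images `{n | ∃ m ∈ S, (m, n) ∈ R}` under coded relations `R ⊆ ℕ × ℕ`, for all large `α`. This
follows from the separation schema (`chi_mem_model_of_dfn`), once an injection of `ℕ × ℕ` into `ℕ`
is seen to be definable in each `M α` (`codeRel_iff`). A polynomial serves as this injection; addition
and multiplication are definable by iteration, where the course of a finite iteration is a finite
set and therefore belongs to `M α` (`iterRel_iff`).
-/

universe v

open Filter

namespace Slicing

open FirstOrder FirstOrder.Language

/-! ### Definable relations on a class -/

theorem realize_fMem {M : Set ZFSet.{u}} {k : ℕ} (i j : Fin k) (e : Empty → M) (v : Fin k → M) :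
    (fMem i j).Realize (M := M) e v ↔ (v i : ZFSet) ∈ (v j : ZFSet) :=
  (BoundedFormula.realize_rel₂ (L := setLang) (M := M) (R := MemRel.mem)).trans Iff.rfl

theorem realize_fEq {M : Set ZFSet.{u}} {k : ℕ} (i j : Fin k) (e : Empty → M) (v : Fin k → M) :
    (fEq i j).Realize (M := M) e v ↔ v i = v j :=
  Iff.rfl

theorem realize_fInst {M : Set ZFSet.{u}} {n m k : ℕ} (φ : setLang.Formula (Fin n ⊕ Fin k))
    (t : Fin k → Fin (n + m)) (e : Empty → M) (v : Fin (n + m) → M) :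
    (fInst φ t).Realize (M := M) e v ↔
      φ.Realize (M := M) (Sum.elim (fun i => v (Fin.castAdd m i)) fun j => v (t j)) := by
  have h := BoundedFormula.realize_relabel (M := M) (φ := φ) (v := e) (xs := v)
    (g := Sum.elim (fun i => Sum.inr (Fin.castAdd m i)) fun j => Sum.inr (t j))
  refine h.trans ?_
  rw [Formula.Realize, iff_eq_eq]
  congr 1
  · ext x
    cases x <;> rfl
  · exact Subsingleton.elim _ _

/-- A relation on `k`-tuples from the class `M` is definable (without parameters) over `(M, ∈)`. -/
def Dfn (M : Set ZFSet.{u}) {k : ℕ} (P : (Fin k → M) → Prop) : Prop :=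
  ∃ φ : Fm k, ∀ v : Fin k → M, φ.Realize (M := M) Empty.elim v ↔ P v

namespace Dfn

variable {M : Set ZFSet.{u}} {k : ℕ}

theorem mem (i j : Fin k) : Dfn M fun v => (v i : ZFSet) ∈ (v j : ZFSet) :=
  ⟨fMem i j, fun v => realize_fMem i j _ v⟩

theorem eq (i j : Fin k) : Dfn M fun v => v i = v j :=
  ⟨fEq i j, fun _ => Iff.rfl⟩

theorem not {P : (Fin k → M) → Prop} : Dfn M P → Dfn M fun v => ¬ P v := by
  rintro ⟨φ, hφ⟩
  exact ⟨φ.not, fun v => by rw [BoundedFormula.realize_not, hφ]⟩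

theorem and {P Q : (Fin k → M) → Prop} : Dfn M P → Dfn M Q → Dfn M fun v => P v ∧ Q v := by
  rintro ⟨φ, hφ⟩ ⟨ψ, hψ⟩
  exact ⟨φ ⊓ ψ, fun v => by rw [BoundedFormula.realize_inf, hφ, hψ]⟩

theorem or {P Q : (Fin k → M) → Prop} : Dfn M P → Dfn M Q → Dfn M fun v => P v ∨ Q v := by
  rintro ⟨φ, hφ⟩ ⟨ψ, hψ⟩
  exact ⟨φ ⊔ ψ, fun v => by rw [BoundedFormula.realize_sup, hφ, hψ]⟩

theorem imp {P Q : (Fin k → M) → Prop} : Dfn M P → Dfn M Q → Dfn M fun v => P v → Q v := by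
  rintro ⟨φ, hφ⟩ ⟨ψ, hψ⟩
  exact ⟨φ.imp ψ, fun v => by rw [BoundedFormula.realize_imp, hφ, hψ]⟩

theorem iff {P Q : (Fin k → M) → Prop} : Dfn M P → Dfn M Q → Dfn M fun v => P v ↔ Q v := by
  rintro ⟨φ, hφ⟩ ⟨ψ, hψ⟩
  exact ⟨φ.iff ψ, fun v => by rw [BoundedFormula.realize_iff, hφ, hψ]⟩

/-- The bound variable of a quantifier is the last entry of the extended tuple. -/
theorem ex {P : (Fin k → M) → M → Prop}
    (h : Dfn M fun v : Fin (k + 1) → M => P (fun i => v i.castSucc) (v (Fin.last k))) :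
    Dfn M fun v => ∃ x, P v x := by
  obtain ⟨φ, hφ⟩ := h
  exact ⟨φ.ex, fun v => by simp [hφ]⟩

theorem all {P : (Fin k → M) → M → Prop}
    (h : Dfn M fun v : Fin (k + 1) → M => P (fun i => v i.castSucc) (v (Fin.last k))) :
    Dfn M fun v => ∀ x, P v x := by
  obtain ⟨φ, hφ⟩ := h
  exact ⟨φ.all, fun v => by simp [hφ]⟩

theorem congr {P Q : (Fin k → M) → Prop} (h : Dfn M P) (hPQ : ∀ v, P v ↔ Q v) : Dfn M Q := by
  obtain ⟨φ, hφ⟩ := h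
  exact ⟨φ, fun v => (hφ v).trans (hPQ v)⟩

end Dfn

/-! ### Elementary set theory inside a transitive model -/

section Model

variable {M : Set ZFSet.{u}}

theorem exists_sep (hM : M ⊨ ZFC) {n : ℕ} {P : (Fin (n + 1) → M) → Prop} (hP : Dfn M P)
    (p : Fin n → M) (a : M) :
    ∃ b : M, ∀ z : M, (z : ZFSet) ∈ (b : ZFSet) ↔
      (z : ZFSet) ∈ (a : ZFSet) ∧ P (Fin.snoc p z) := by
  obtain ⟨φ, hφ⟩ := hP
  -- The separation schema takes formulas whose free variables are split into parameters and
  -- the separated variable.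
  let ψ : setLang.Formula (Fin n ⊕ Fin 1) :=
    φ.toFormula.relabel (Sum.elim Empty.elim
      (Fin.snoc (α := fun _ => Fin n ⊕ Fin 1) Sum.inl (Sum.inr 0)))
  have hax : M ⊨ axSeparation n ψ :=
    hM.realize_of_mem _ (Or.inl (Or.inr ⟨n, ψ, rfl⟩))
  have h := (BoundedFormula.realize_alls.1 hax) p a
  obtain ⟨b, hb⟩ := BoundedFormula.realize_ex.1 h
  refine ⟨b, fun z => ?_⟩
  have hz := hb z
  rw [BoundedFormula.realize_iff, BoundedFormula.realize_inf, realize_fMem, realize_fMem,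
    realize_fInst, Formula.realize_relabel, BoundedFormula.realize_toFormula] at hz
  simp only [Fin.snoc_castSucc, Fin.snoc_last] at hz
  rw [hz, ← hφ]
  refine and_congr_right fun _ => iff_of_eq ?_
  congr 1
  · exact Subsingleton.elim _ _
  · funext i
    refine Fin.lastCases ?_ (fun i => ?_) i
    · simp
    · have hi : Fin.castAdd 3 i = i.castSucc.castSucc.castSucc := rfl
      simp only [Function.comp_apply, Fin.snoc_castSucc, Sum.elim_inr, Sum.elim_inl, hi]

theorem pair_mem_model (hM : M ⊨ ZFC) (hT : TransitiveClass M) {x y : ZFSet.{u}} (hx : x ∈ M)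
    (hy : y ∈ M) : ({x, y} : ZFSet.{u}) ∈ M := by
  have hax : M ⊨ axPairing := hM.realize_of_mem _ (Or.inl (Or.inl (by simp)))
  obtain ⟨p, hp⟩ := BoundedFormula.realize_ex.1 (hax ⟨x, hx⟩ ⟨y, hy⟩)
  have h : (p : ZFSet) = {x, y} := by
    ext z
    rw [ZFSet.mem_pair]
    by_cases hz : z ∈ M
    · have := hp ⟨z, hz⟩
      rw [BoundedFormula.realize_iff, BoundedFormula.realize_sup, realize_fMem, realize_fEq,
        realize_fEq] at this
      simpa [Fin.snoc, Subtype.ext_iff] using this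
    · refine iff_of_false (fun h => hz (hT _ p.2 _ h)) ?_
      rintro (rfl | rfl) <;> contradiction
  exact h ▸ p.2

theorem sUnion_mem_model (hM : M ⊨ ZFC) (hT : TransitiveClass M) {x : ZFSet.{u}} (hx : x ∈ M) :
    (ZFSet.sUnion x) ∈ M := by
  have hax : M ⊨ axUnion := hM.realize_of_mem _ (Or.inl (Or.inl (by simp)))
  obtain ⟨p, hp⟩ := BoundedFormula.realize_ex.1 (hax ⟨x, hx⟩)
  have h : (p : ZFSet) = ZFSet.sUnion x := by
    ext z
    rw [ZFSet.mem_sUnion]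
    by_cases hz : z ∈ M
    · have := hp ⟨z, hz⟩
      rw [BoundedFormula.realize_iff, realize_fMem, fExMem, fEx, BoundedFormula.realize_ex] at this
      simp only [BoundedFormula.realize_inf, realize_fMem] at this
      simp only [Fin.snoc_castSucc, Fin.snoc_last] at this
      rw [this]
      constructor
      · rintro ⟨y, hy, h⟩
        exact ⟨y, hy, h⟩
      · rintro ⟨y, hy, h⟩
        exact ⟨⟨y, hT _ hx _ hy⟩, hy, h⟩
    · refine iff_of_false (fun h => hz (hT _ p.2 _ h)) ?_
      rintro ⟨y, hy, h⟩
      exact hz (hT _ (hT _ hx _ hy) _ h)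
  exact h ▸ p.2

theorem insert_mem_model (hM : M ⊨ ZFC) (hT : TransitiveClass M) {x y : ZFSet.{u}} (hx : x ∈ M)
    (hy : y ∈ M) : (insert x y : ZFSet.{u}) ∈ M := by
  have h := sUnion_mem_model hM hT
    (pair_mem_model hM hT (pair_mem_model hM hT hx hx) hy)
  rwa [ZFSet.sUnion_pair, ZFSet.pair_eq_singleton, ← ZFSet.insert_eq] at h

theorem opair_mem_model (hM : M ⊨ ZFC) (hT : TransitiveClass M) {x y : ZFSet.{u}} (hx : x ∈ M)
    (hy : y ∈ M) : ZFSet.pair x y ∈ M := by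
  have h := pair_mem_model hM hT (pair_mem_model hM hT hx hx) (pair_mem_model hM hT hx hy)
  rwa [ZFSet.pair_eq_singleton] at h

theorem mem_model_of_opair (hT : TransitiveClass M) {x y : ZFSet.{u}} (h : ZFSet.pair x y ∈ M) :
    x ∈ M ∧ y ∈ M := by
  have h1 : ({x, y} : ZFSet.{u}) ∈ M := hT _ h _ (by simp [ZFSet.pair])
  exact ⟨hT _ h1 _ (by simp), hT _ h1 _ (by simp)⟩

/-! ### Absolutely definable notions -/

namespace Dfn

variable {k : ℕ}

theorem isEmpty (hT : TransitiveClass M) (i : Fin k) : Dfn M fun v => (v i : ZFSet) = ∅ := by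
  refine (all (P := fun v x => ¬ (x : ZFSet) ∈ (v i : ZFSet)) (mem _ _).not).congr fun v => ?_
  rw [ZFSet.eq_empty]
  exact ⟨fun h y hy => h ⟨y, hT _ (v i).2 _ hy⟩ hy, fun h y => h y⟩

theorem isPair (hT : TransitiveClass M) (i j l : Fin k) :
    Dfn M fun v => (v i : ZFSet) = {(v j : ZFSet), (v l : ZFSet)} := by
  refine (all (P := fun v x => (x : ZFSet) ∈ (v i : ZFSet) ↔ x = v j ∨ x = v l)
    ((mem _ _).iff ((eq _ _).or (eq _ _)))).congr fun v => ?_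
  constructor
  · intro h
    ext z
    rw [ZFSet.mem_pair]
    by_cases hz : z ∈ M
    · simpa [Subtype.ext_iff] using h ⟨z, hz⟩
    · refine iff_of_false (fun h => hz (hT _ (v i).2 _ h)) ?_
      rintro (rfl | rfl)
      exacts [hz (v j).2, hz (v l).2]
  · intro h x
    rw [h, ZFSet.mem_pair, Subtype.ext_iff, Subtype.ext_iff]

theorem isSucc (hT : TransitiveClass M) (i j : Fin k) :
    Dfn M fun v => (v i : ZFSet) = insert (v j : ZFSet) (v j : ZFSet) := by
  refine (all (P := fun v x => (x : ZFSet) ∈ (v i : ZFSet) ↔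
      x = v j ∨ (x : ZFSet) ∈ (v j : ZFSet))
    ((mem _ _).iff ((eq _ _).or (mem _ _)))).congr fun v => ?_
  constructor
  · intro h
    ext z
    rw [ZFSet.mem_insert_iff]
    by_cases hz : z ∈ M
    · simpa [Subtype.ext_iff] using h ⟨z, hz⟩
    · refine iff_of_false (fun h => hz (hT _ (v i).2 _ h)) ?_
      rintro (rfl | h)
      exacts [hz (v j).2, hz (hT _ (v j).2 _ h)]
  · intro h x
    rw [h, ZFSet.mem_insert_iff, Subtype.ext_iff]

theorem isOPair (hM : M ⊨ ZFC) (hT : TransitiveClass M) (i j l : Fin k) :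
    Dfn M fun v => (v i : ZFSet) = ZFSet.pair (v j) (v l) := by
  refine (ex (P := fun v s => ∃ d : M, (s : ZFSet) = {(v j : ZFSet), (v j : ZFSet)} ∧
      (d : ZFSet) = {(v j : ZFSet), (v l : ZFSet)} ∧ (v i : ZFSet) = {(s : ZFSet), (d : ZFSet)})
    (ex ((isPair hT _ _ _).and ((isPair hT _ _ _).and (isPair hT _ _ _))))).congr fun v => ?_
  constructor
  · rintro ⟨s, d, hs, hd, h⟩
    rw [h, hs, hd, ZFSet.pair_eq_singleton, ZFSet.pair]
  · intro h
    refine ⟨⟨_, pair_mem_model hM hT (v j).2 (v j).2⟩, ⟨_, pair_mem_model hM hT (v j).2 (v l).2⟩,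
      rfl, rfl, ?_⟩
    rw [h]
    simp [ZFSet.pair]

theorem opairMem (hM : M ⊨ ZFC) (hT : TransitiveClass M) (i j l : Fin k) :
    Dfn M fun v => ZFSet.pair (v i) (v j) ∈ (v l : ZFSet) := by
  refine (ex (P := fun v q => (q : ZFSet) = ZFSet.pair (v i) (v j) ∧ (q : ZFSet) ∈ (v l : ZFSet))
    ((isOPair hM hT _ _ _).and (mem _ _))).congr fun v => ?_
  constructor
  · rintro ⟨q, hq, h⟩
    exact hq ▸ h
  · exact fun h => ⟨⟨_, hT _ (v l).2 _ h⟩, rfl, h⟩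

end Dfn

end Model

/-! ### Arithmetic inside a transitive model -/

/-- The von Neumann natural number `n`. -/
noncomputable def nat (n : ℕ) : ZFSet.{u} := (n : Ordinal.{u}).toZFSet

@[simp] theorem nat_zero : nat.{u} 0 = ∅ := by simp [nat]

theorem nat_succ (n : ℕ) : nat.{u} (n + 1) = insert (nat n) (nat n) := by
  rw [nat, Nat.cast_succ]
  exact Ordinal.toZFSet_add_one _

theorem nat_injective : Function.Injective nat.{u} :=
  Ordinal.toZFSet_injective.comp Nat.cast_injective

@[simp] theorem nat_inj {m n : ℕ} : nat.{u} m = nat n ↔ m = n := nat_injective.eq_iff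

theorem nat_succ_ne_empty (n : ℕ) : nat.{u} (n + 1) ≠ ∅ := by
  rw [← nat_zero, Ne, nat_inj]
  exact n.succ_ne_zero

theorem mem_omega_toZFSet {x : ZFSet.{u}} : x ∈ (ω : Ordinal.{u}).toZFSet ↔ ∃ n, x = nat n := by
  rw [Ordinal.mem_toZFSet_iff]
  constructor
  · rintro ⟨a, ha, rfl⟩
    obtain ⟨n, rfl⟩ := Ordinal.lt_omega0.1 ha
    exact ⟨n, rfl⟩
  · rintro ⟨n, rfl⟩
    exact ⟨n, Ordinal.natCast_lt_omega0 n, rfl⟩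

theorem insert_self_eq_nat {n : ℕ} {y : ZFSet.{u}} (h : insert y y = nat (n + 1)) : y = nat n := by
  have hy : y ∈ nat.{u} (n + 1) := h ▸ ZFSet.mem_insert y y
  rw [nat_succ, ZFSet.mem_insert_iff] at hy
  rcases hy with hy | hy
  · exact hy
  · have h' : nat.{u} n ∈ (insert y y : ZFSet.{u}) := by
      rw [h, nat_succ]
      exact ZFSet.mem_insert _ _
    rw [ZFSet.mem_insert_iff] at h'
    rcases h' with h' | h'
    · exact h'.symm
    · exact absurd h' (ZFSet.mem_asymm hy)

section Model

variable {M : Set ZFSet.{u}}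

/-- `y` is the `n`-th iterate at `a` of the partial function with graph `h`: this is witnessed by a
set `g ∈ M` of pairs that contains `(n, y)` and in which each pair either is `(0, a)` or
arises from another pair of `g` by one step of the iteration. -/
def IterRel (h : M → M → Prop) (a n y : M) : Prop :=
  ∃ g : M, ZFSet.pair n y ∈ (g : ZFSet) ∧ ∀ q : M, (q : ZFSet) ∈ (g : ZFSet) →
    ∃ i x : M, (q : ZFSet) = ZFSet.pair i x ∧
      (((i : ZFSet) = ∅ ∧ x = a) ∨
        ∃ j w : M, ZFSet.pair j w ∈ (g : ZFSet) ∧ (i : ZFSet) = insert (j : ZFSet) (j : ZFSet) ∧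
          h w x)

/-- `y = a + n`. -/
def AddRel (a n y : M) : Prop :=
  IterRel (fun x w => (w : ZFSet) = insert (x : ZFSet) (x : ZFSet)) a n y

/-- `y = m * n`, as the result of adding `m` to `0` for `n` times. -/
def MulRel (m n y : M) : Prop :=
  ∃ z : M, (z : ZFSet) = ∅ ∧ IterRel (fun x w => AddRel x m w) z n y

/-- An injective polynomial coding of pairs of natural numbers. -/
def code (m n : ℕ) : ℕ := (m + n) * (m + n) + m

theorem code_inj {m n m' n' : ℕ} (h : code m n = code m' n') : m = m' ∧ n = n' := by
  have key : ∀ a b, Nat.sqrt (code a b) = a + b := fun a b =>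
    Nat.sqrt_add_eq _ (by omega)
  have hs : m + n = m' + n' := by rw [← key, h, key]
  have hm : m = m' := by
    rw [code, code, hs] at h
    exact Nat.add_left_cancel h
  exact ⟨hm, by omega⟩

/-- `y = code m n`. -/
def CodeRel (m n y : M) : Prop :=
  ∃ s t : M, AddRel m n s ∧ MulRel s s t ∧ AddRel t m y

namespace Dfn

variable {k : ℕ}

/-- The step relation `h` may depend on a parameter, which has to remain a variable. -/
theorem iterRel (hM : M ⊨ ZFC) (hT : TransitiveClass M) {h : M → M → M → Prop}
    (H : ∀ {k : ℕ} (p i j : Fin k), Dfn M fun v => h (v p) (v i) (v j)) (p a n y : Fin k) :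
    Dfn M fun v => IterRel (h (v p)) (v a) (v n) (v y) :=
  ex ((opairMem hM hT _ _ _).and (all ((mem _ _).imp (ex (ex ((isOPair hM hT _ _ _).and
    (((isEmpty hT _).and (eq _ _)).or
      (ex (ex ((opairMem hM hT _ _ _).and ((isSucc hT _ _).and (H _ _ _))))))))))))

theorem addRel (hM : M ⊨ ZFC) (hT : TransitiveClass M) (a n y : Fin k) :
    Dfn M fun v => AddRel (v a) (v n) (v y) :=
  iterRel hM hT (h := fun _ x w => (w : ZFSet) = insert (x : ZFSet) (x : ZFSet))
    (fun _ _ _ => isSucc hT _ _) a a n y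

theorem mulRel (hM : M ⊨ ZFC) (hT : TransitiveClass M) (m n y : Fin k) :
    Dfn M fun v => MulRel (v m) (v n) (v y) :=
  ex ((isEmpty hT _).and (iterRel hM hT (h := fun m x w => AddRel x m w)
    (fun _ _ _ => addRel hM hT _ _ _) m.castSucc _ _ _))

theorem codeRel (hM : M ⊨ ZFC) (hT : TransitiveClass M) (m n y : Fin k) :
    Dfn M fun v => CodeRel (v m) (v n) (v y) :=
  ex (ex ((addRel hM hT _ _ _).and ((mulRel hM hT _ _ _).and (addRel hM hT _ _ _))))

end Dfn

/-- The relation `IterRel` is absolute: the witnesses needed for it are finite sets. -/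
theorem iterRel_iff (hM : M ⊨ ZFC) (hT : TransitiveClass M) (hN : ∀ n, nat n ∈ M)
    {h : M → M → Prop} {f : ℕ → ℕ} (hf : ∀ (x : ℕ) (w : M), h ⟨nat x, hN x⟩ w ↔ w = nat (f x))
    (a n : ℕ) (y : M) :
    IterRel h ⟨nat a, hN a⟩ ⟨nat n, hN n⟩ y ↔ (y : ZFSet) = nat (f^[n] a) := by
  constructor
  · rintro ⟨g, hg, hstep⟩
    have key : ∀ (n : ℕ) (y : M), ZFSet.pair (nat n) y ∈ (g : ZFSet) →
        (y : ZFSet) = nat (f^[n] a) := by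
      intro n
      induction n with
      | zero =>
        intro y hy
        obtain ⟨i, x, hq, h0 | ⟨j, w, -, hj, -⟩⟩ := hstep ⟨_, hT _ g.2 _ hy⟩ hy
        · obtain ⟨-, hx⟩ := ZFSet.pair_injective hq
          rw [hx, h0.2]
          rfl
        · obtain ⟨hi, -⟩ := ZFSet.pair_injective hq
          rw [nat_zero, hj] at hi
          exact absurd (hi ▸ ZFSet.mem_insert _ _) (ZFSet.notMem_empty (j : ZFSet))
      | succ n ih =>
        intro y hy
        obtain ⟨i, x, hq, h0 | ⟨j, w, hjw, hj, hw⟩⟩ := hstep ⟨_, hT _ g.2 _ hy⟩ hy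
        · obtain ⟨hi, -⟩ := ZFSet.pair_injective hq
          exact absurd (hi.trans h0.1) (nat_succ_ne_empty n)
        · obtain ⟨hi, hx⟩ := ZFSet.pair_injective hq
          have hjn := insert_self_eq_nat (hj.symm.trans hi.symm)
          rw [hjn] at hjw
          have hw' : w = ⟨nat (f^[n] a), hN _⟩ := Subtype.ext (ih w hjw)
          rw [hw', hf] at hw
          rw [hx, hw, Function.iterate_succ_apply']
    exact key n y hg
  · intro hy
    have hfin : ∀ n : ℕ, ∃ g ∈ M, ∀ q, q ∈ g ↔ ∃ i ≤ n, q = ZFSet.pair (nat i) (nat (f^[i] a)) := by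
      intro n
      induction n with
      | zero =>
        have h0 := opair_mem_model hM hT (hN 0) (hN a)
        exact ⟨_, pair_mem_model hM hT h0 h0, fun q => by simp⟩
      | succ n ih =>
        obtain ⟨g, hg, hgq⟩ := ih
        refine ⟨_, insert_mem_model hM hT
          (opair_mem_model hM hT (hN (n + 1)) (hN (f^[n + 1] a))) hg, fun q => ?_⟩
        rw [ZFSet.mem_insert_iff, hgq]
        constructor
        · rintro (rfl | ⟨i, hi, rfl⟩)
          exacts [⟨n + 1, le_rfl, rfl⟩, ⟨i, hi.trans n.le_succ, rfl⟩]
        · rintro ⟨i, hi, rfl⟩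
          rcases hi.lt_or_eq with hi | rfl
          exacts [Or.inr ⟨i, Nat.lt_succ_iff.1 hi, rfl⟩, Or.inl rfl]
    obtain ⟨g, hg, hgq⟩ := hfin n
    refine ⟨⟨g, hg⟩, (hgq _).2 ⟨n, le_rfl, by rw [hy]⟩, fun q hq => ?_⟩
    obtain ⟨i, hi, hqi⟩ := (hgq _).1 hq
    refine ⟨⟨nat i, hN i⟩, ⟨nat (f^[i] a), hN _⟩, hqi, ?_⟩
    rcases i with _ | i
    · exact Or.inl ⟨nat_zero, rfl⟩
    · refine Or.inr ⟨⟨nat i, hN i⟩, ⟨nat (f^[i] a), hN _⟩, (hgq _).2 ⟨i, by omega, rfl⟩,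
        nat_succ i, ?_⟩
      rw [hf, Function.iterate_succ_apply']

theorem addRel_iff (hM : M ⊨ ZFC) (hT : TransitiveClass M) (hN : ∀ n, nat n ∈ M)
    (a n : ℕ) (y : M) :
    AddRel ⟨nat a, hN a⟩ ⟨nat n, hN n⟩ y ↔ (y : ZFSet) = nat (a + n) := by
  rw [AddRel, iterRel_iff hM hT hN (f := Nat.succ) (fun x w => by rw [nat_succ]),
    Nat.succ_iterate]

theorem mulRel_iff (hM : M ⊨ ZFC) (hT : TransitiveClass M) (hN : ∀ n, nat n ∈ M)
    (m n : ℕ) (y : M) :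
    MulRel ⟨nat m, hN m⟩ ⟨nat n, hN n⟩ y ↔ (y : ZFSet) = nat (m * n) := by
  have h := iterRel_iff hM hT hN (h := fun x w => AddRel x ⟨nat m, hN m⟩ w) (f := (· + m))
    (fun x w => addRel_iff hM hT hN x m w) 0 n y
  simp only [add_right_iterate, zero_add, smul_eq_mul, mul_comm n m] at h
  rw [← h]
  constructor
  · rintro ⟨z, hz, h⟩
    have hz' : z = ⟨nat 0, hN 0⟩ := Subtype.ext (hz.trans nat_zero.symm)
    exact hz' ▸ h
  · exact fun h => ⟨_, nat_zero, h⟩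

theorem codeRel_iff (hM : M ⊨ ZFC) (hT : TransitiveClass M) (hN : ∀ n, nat n ∈ M)
    (m n : ℕ) (y : M) :
    CodeRel ⟨nat m, hN m⟩ ⟨nat n, hN n⟩ y ↔ (y : ZFSet) = nat (code m n) := by
  constructor
  · rintro ⟨s, t, hs, ht, hy⟩
    obtain rfl : s = ⟨_, hN _⟩ := Subtype.ext ((addRel_iff hM hT hN m n s).1 hs)
    obtain rfl : t = ⟨_, hN _⟩ := Subtype.ext ((mulRel_iff hM hT hN _ _ t).1 ht)
    exact (addRel_iff hM hT hN _ _ y).1 hy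
  · exact fun hy => ⟨⟨nat (m + n), hN _⟩, ⟨nat ((m + n) * (m + n)), hN _⟩,
      (addRel_iff hM hT hN _ _ _).2 rfl, (mulRel_iff hM hT hN _ _ _).2 rfl,
      (addRel_iff hM hT hN _ _ _).2 hy⟩

end Model

/-! ### Characteristic functions of sets of natural numbers -/

open Classical in
/-- The characteristic function of `S ⊆ ℕ`, as an element of `2 ^ ω`. -/
noncomputable def chi (S : Set ℕ) : ZFSet.{u} :=
  ZFSet.sep (fun q => ∃ n, q = ZFSet.pair (nat n) (nat (if n ∈ S then 1 else 0)))
    (ZFSet.prod (ω : Ordinal.{u}).toZFSet (2 : Ordinal.{u}).toZFSet)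

theorem mem_two_toZFSet {x : ZFSet.{u}} :
    x ∈ (2 : Ordinal.{u}).toZFSet ↔ x = nat 0 ∨ x = nat 1 := by
  have h : (2 : Ordinal.{u}).toZFSet = nat 2 := by rw [nat]; norm_num
  rw [h, nat_succ, nat_succ, ZFSet.mem_insert_iff, ZFSet.mem_insert_iff, ← nat_succ]
  simp [or_comm]

open Classical in
theorem mem_chi {S : Set ℕ} {q : ZFSet.{u}} :
    q ∈ chi S ↔ ∃ n, q = ZFSet.pair (nat n) (nat (if n ∈ S then 1 else 0)) := by
  rw [chi, ZFSet.mem_sep, and_iff_right_iff_imp]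
  rintro ⟨n, rfl⟩
  rw [ZFSet.pair_mem_prod, mem_omega_toZFSet, mem_two_toZFSet]
  refine ⟨⟨n, rfl⟩, ?_⟩
  split_ifs <;> simp

open Classical in
theorem pair_mem_chi {S : Set ℕ} {n : ℕ} {b : ZFSet.{u}} :
    ZFSet.pair (nat n) b ∈ chi S ↔ b = nat (if n ∈ S then 1 else 0) := by
  rw [mem_chi]
  constructor
  · rintro ⟨m, hm⟩
    obtain ⟨h1, h2⟩ := ZFSet.pair_injective hm
    rw [nat_inj] at h1
    rw [h2, h1]
  · rintro rfl
    exact ⟨n, rfl⟩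

theorem chi_mem_twoPow (S : Set ℕ) : chi S ∈ twoPow (ω : Ordinal.{u}) := by
  classical
  rw [twoPow, ZFSet.mem_funs]
  refine ⟨ZFSet.sep_subset, fun z hz => ?_⟩
  obtain ⟨n, rfl⟩ := mem_omega_toZFSet.1 hz
  exact ⟨_, pair_mem_chi.2 rfl, fun y hy => pair_mem_chi.1 hy⟩

theorem exists_eq_chi {x : ZFSet.{u}} (hx : x ∈ twoPow (ω : Ordinal.{u})) : ∃ S, x = chi S := by
  classical
  rw [twoPow, ZFSet.mem_funs] at hx
  refine ⟨{n | ZFSet.pair (nat n) (nat 1) ∈ x}, ?_⟩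
  have key : ∀ (n : ℕ) (b : ZFSet.{u}), ZFSet.pair (nat n) b ∈ x →
      b = nat (if n ∈ {n | ZFSet.pair (nat n) (nat 1) ∈ x} then 1 else 0) := by
    intro n b hb
    obtain ⟨w, -, hu⟩ := hx.2 _ (mem_omega_toZFSet.2 ⟨n, rfl⟩)
    rcases mem_two_toZFSet.1 (ZFSet.pair_mem_prod.1 (hx.1 hb)).2 with rfl | rfl
    · rw [if_neg]
      intro h
      exact zero_ne_one (nat_inj.1 ((hu _ hb).trans (hu (nat 1) h).symm))
    · rw [if_pos (by exact hb)]
  ext q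
  rw [mem_chi]
  constructor
  · intro hq
    obtain ⟨a, ha, b, -, rfl⟩ := ZFSet.mem_prod.1 (hx.1 hq)
    obtain ⟨n, rfl⟩ := mem_omega_toZFSet.1 ha
    exact ⟨n, by rw [← key n b hq]⟩
  · rintro ⟨n, rfl⟩
    obtain ⟨w, hw, -⟩ := hx.2 _ (mem_omega_toZFSet.2 ⟨n, rfl⟩)
    rw [← key n w hw]
    exact hw

/-- `n ∈ S` if `x = chi S` and `n` is a natural number. -/
def CharMem {M : Set ZFSet.{u}} (n x : M) : Prop :=
  ∃ b : M, ¬ (b : ZFSet) = ∅ ∧ ZFSet.pair n b ∈ (x : ZFSet)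

section Model

variable {M : Set ZFSet.{u}}

theorem Dfn.charMem (hM : M ⊨ ZFC) (hT : TransitiveClass M) {k : ℕ} (n x : Fin k) :
    Dfn M fun v => CharMem (v n) (v x) :=
  ex ((isEmpty hT _).not.and (opairMem hM hT _ _ _))

theorem charMem_chi (hT : TransitiveClass M) {S : Set ℕ} (hS : chi S ∈ M) (n : M) :
    CharMem n ⟨chi S, hS⟩ ↔ ∃ m ∈ S, (n : ZFSet) = nat m := by
  classical
  constructor
  · rintro ⟨b, hb, h⟩
    obtain ⟨m, hm⟩ := mem_chi.1 h
    obtain ⟨h1, h2⟩ := ZFSet.pair_injective hm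
    refine ⟨m, ?_, h1⟩
    by_contra hmS
    rw [if_neg hmS, nat_zero] at h2
    exact hb h2
  · rintro ⟨m, hmS, hm⟩
    have h : ZFSet.pair n (nat 1) ∈ chi S := by
      rw [hm, pair_mem_chi, if_pos hmS]
    exact ⟨⟨nat 1, (mem_model_of_opair hT (hT _ hS _ h)).2⟩, nat_succ_ne_empty 0, h⟩

theorem nat_mem_model (hT : TransitiveClass M) {S : Set ℕ} (hS : chi S ∈ M) (n : ℕ) :
    nat n ∈ M := by
  classical
  exact (mem_model_of_opair hT (hT _ hS _ (pair_mem_chi.2 rfl))).1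

theorem chi_empty_union_chi_univ :
    chi ∅ ∪ chi Set.univ =
      ZFSet.prod (ω : Ordinal.{u}).toZFSet (2 : Ordinal.{u}).toZFSet := by
  ext q
  simp only [ZFSet.mem_union, mem_chi, ZFSet.mem_prod, mem_omega_toZFSet, mem_two_toZFSet]
  constructor
  · rintro (⟨n, rfl⟩ | ⟨n, rfl⟩)
    exacts [⟨_, ⟨n, rfl⟩, _, Or.inl rfl, by simp⟩, ⟨_, ⟨n, rfl⟩, _, Or.inr rfl, by simp⟩]
  · rintro ⟨_, ⟨n, rfl⟩, _, rfl | rfl, rfl⟩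
    exacts [Or.inl ⟨n, by simp⟩, Or.inr ⟨n, by simp⟩]

/-- A set of natural numbers that is definable in `M` from parameters has its characteristic
function in `M`. The definability hypothesis says that `P p z` is definable whichever variables
stand for the parameters `p` and for `z`. -/
theorem chi_mem_model_of_dfn (hM : M ⊨ ZFC) (hT : TransitiveClass M)
    (h0 : chi ∅ ∈ M) (h1 : chi Set.univ ∈ M) {n : ℕ} {P : (Fin n → M) → M → Prop}
    (hP : ∀ {k : ℕ} (σ : Fin n → Fin k) (z : Fin k), Dfn M fun v => P (fun i => v (σ i)) (v z))
    (p : Fin n → M) {S : Set ℕ} (hS : ∀ m : ℕ, m ∈ S ↔ P p ⟨nat m, nat_mem_model hT h0 m⟩) :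
    chi S ∈ M := by
  classical
  have hW : ZFSet.prod (ω : Ordinal.{u}).toZFSet (2 : Ordinal.{u}).toZFSet ∈ M := by
    rw [← chi_empty_union_chi_univ, ← ZFSet.sUnion_pair]
    exact sUnion_mem_model hM hT (pair_mem_model hM hT h0 h1)
  have hQ : Dfn M fun v : Fin (n + 1) → M => ∃ m b : M,
      (v (Fin.last n) : ZFSet) = ZFSet.pair m b ∧
        ((b : ZFSet) = ∅ ↔ ¬ P (fun i => v i.castSucc) m) :=
    Dfn.ex (Dfn.ex ((Dfn.isOPair hM hT _ _ _).and ((Dfn.isEmpty hT _).iff (hP _ _).not)))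
  obtain ⟨b, hb⟩ := exists_sep hM hQ p ⟨_, hW⟩
  have : (b : ZFSet) = chi S := by
    ext q
    rw [mem_chi]
    by_cases hq : q ∈ M
    · rw [hb ⟨q, hq⟩]
      simp only [Fin.snoc_last, Fin.snoc_castSucc, ZFSet.mem_prod, mem_omega_toZFSet,
        mem_two_toZFSet]
      constructor
      · rintro ⟨⟨_, ⟨m, rfl⟩, _, hc, rfl⟩, m', c, hmc, h⟩
        obtain ⟨hm, rfl⟩ := ZFSet.pair_injective hmc
        have hm' : m' = ⟨nat m, nat_mem_model hT h0 m⟩ := Subtype.ext hm.symm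
        rw [hm', ← hS] at h
        refine ⟨m, ?_⟩
        split_ifs with hmS
        · rcases hc with hc | hc
          · exact absurd hmS (h.1 (hc.trans nat_zero))
          · rw [hc]
        · rw [h.2 hmS, nat_zero]
      · rintro ⟨m, rfl⟩
        refine ⟨⟨_, ⟨m, rfl⟩, _, ?_, rfl⟩, ⟨nat m, nat_mem_model hT h0 m⟩,
          ⟨_, nat_mem_model hT h0 _⟩, rfl, ?_⟩
        · split_ifs <;> simp
        · rw [← hS]
          split_ifs with hmS
          · simpa [hmS] using nat_succ_ne_empty 0
          · simp [hmS]
    · refine iff_of_false (fun h => hq (hT _ b.2 _ h)) ?_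
      rintro ⟨m, rfl⟩
      exact hq (opair_mem_model hM hT (nat_mem_model hT h0 _) (nat_mem_model hT h0 _))
  exact this ▸ b.2

theorem chi_compl_mem_model (hM : M ⊨ ZFC) (hT : TransitiveClass M)
    (h0 : chi ∅ ∈ M) (h1 : chi Set.univ ∈ M) {S : Set ℕ} (hS : chi S ∈ M) : chi Sᶜ ∈ M := by
  refine chi_mem_model_of_dfn hM hT h0 h1 (n := 1) (P := fun p z => ¬ CharMem z (p 0))
    (fun σ z => (Dfn.charMem hM hT z (σ 0)).not) (fun _ => ⟨_, hS⟩) fun m => ?_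
  rw [charMem_chi hT]
  simp

theorem chi_inter_mem_model (hM : M ⊨ ZFC) (hT : TransitiveClass M)
    (h0 : chi ∅ ∈ M) (h1 : chi Set.univ ∈ M) {S T : Set ℕ} (hS : chi S ∈ M) (hT' : chi T ∈ M) :
    chi (S ∩ T) ∈ M := by
  refine chi_mem_model_of_dfn hM hT h0 h1 (n := 2)
    (P := fun p z => CharMem z (p 0) ∧ CharMem z (p 1))
    (fun σ z => (Dfn.charMem hM hT z (σ 0)).and (Dfn.charMem hM hT z (σ 1)))
    ![⟨_, hS⟩, ⟨_, hT'⟩] fun m => ?_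
  change _ ↔ CharMem _ ⟨chi S, hS⟩ ∧ CharMem _ ⟨chi T, hT'⟩
  rw [charMem_chi hT, charMem_chi hT]
  simp

theorem chi_image_mem_model (hM : M ⊨ ZFC) (hT : TransitiveClass M)
    (h0 : chi ∅ ∈ M) (h1 : chi Set.univ ∈ M) {R S : Set ℕ} (hR : chi R ∈ M) (hS : chi S ∈ M) :
    chi {n | ∃ m ∈ S, code m n ∈ R} ∈ M := by
  refine chi_mem_model_of_dfn hM hT h0 h1 (n := 2)
    (P := fun p z => ∃ m c : M, CharMem m (p 1) ∧ CodeRel m z c ∧ CharMem c (p 0))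
    (fun σ z => Dfn.ex (Dfn.ex ((Dfn.charMem hM hT _ (σ 1).castSucc.castSucc).and
      ((Dfn.codeRel hM hT _ _ _).and (Dfn.charMem hM hT _ (σ 0).castSucc.castSucc)))))
    ![⟨_, hR⟩, ⟨_, hS⟩] fun n => ?_
  change _ ↔ ∃ m c : M, CharMem m ⟨chi S, hS⟩ ∧ CodeRel m _ c ∧ CharMem c ⟨chi R, hR⟩
  have hN := nat_mem_model hT h0
  constructor
  · rintro ⟨m, hm, hmn⟩
    exact ⟨⟨nat m, hN m⟩, ⟨nat (code m n), hN _⟩, (charMem_chi hT hS _).2 ⟨m, hm, rfl⟩,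
      (codeRel_iff hM hT hN _ _ _).2 rfl, (charMem_chi hT hR _).2 ⟨_, hmn, rfl⟩⟩
  · rintro ⟨m, c, hm, hc, hcR⟩
    obtain ⟨m, hmS, hm⟩ := (charMem_chi hT hS _).1 hm
    obtain rfl : _ = (⟨nat m, hN m⟩ : M) := Subtype.ext hm
    obtain ⟨r, hr, hcr⟩ := (charMem_chi hT hR _).1 hcR
    rw [codeRel_iff hM hT hN, hcr, nat_inj] at hc
    exact ⟨m, hmS, hc ▸ hr⟩

end Model

/-! ### Filtrations of the power set of the natural numbers -/

/-- A strictly increasing family of collections of sets of natural numbers which exhausts the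
power set of `ℕ`, and whose late members are closed under complements, intersections and images
under coded relations. -/
structure Filtration {I : Type*} [LinearOrder I] (A : I → Set (Set ℕ)) : Prop where
  strictMono : StrictMono A
  cover : ∀ S, ∃ i, S ∈ A i
  compl : ∀ᶠ i in atTop, ∀ S ∈ A i, Sᶜ ∈ A i
  inter : ∀ᶠ i in atTop, ∀ S ∈ A i, ∀ T ∈ A i, S ∩ T ∈ A i
  image : ∀ᶠ i in atTop, ∀ R ∈ A i, ∀ S ∈ A i, {n | ∃ m ∈ S, code m n ∈ R} ∈ A i

/-- The subset `S` of the countable type `ι` is coded by a member of `𝒜`. The coding uses the fixed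
bijection between `ι` and `ℕ`. -/
def Coded (𝒜 : Set (Set ℕ)) {ι : Type*} [Denumerable ι] (S : Set ι) : Prop :=
  Denumerable.ofNat ι ⁻¹' S ∈ 𝒜

/-- The lower half of the Dedekind cut of a real number. -/
def cut (x : ℝ) : Set ℚ := {q | (q : ℝ) < x}

namespace Filtration

variable {I : Type*} [LinearOrder I] {A : I → Set (Set ℕ)}

theorem codedCompl (hA : Filtration A) {ι : Type*} [Denumerable ι] :
    ∀ᶠ i in atTop, ∀ S : Set ι, Coded (A i) S → Coded (A i) Sᶜ :=
  hA.compl.mono fun _ hi _ hS => hi _ hS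

theorem codedInter (hA : Filtration A) {ι : Type*} [Denumerable ι] :
    ∀ᶠ i in atTop, ∀ S T : Set ι, Coded (A i) S → Coded (A i) T → Coded (A i) (S ∩ T) :=
  hA.inter.mono fun _ hi _ _ hS hT => hi _ hS _ hT

/-- Every relation between countable types is coded from some stage on, so that from there on the
stages are closed under images by this relation. -/
theorem codedImage (hA : Filtration A) {ι κ : Type*} [Denumerable ι] [Denumerable κ]
    (R : ι → κ → Prop) :
    ∀ᶠ i in atTop, ∀ S : Set ι, Coded (A i) S → Coded (A i) {b | ∃ a ∈ S, R a b} := by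
  let r : Set ℕ :=
    {c | ∃ m n, c = code m n ∧ R (Denumerable.ofNat ι m) (Denumerable.ofNat κ n)}
  obtain ⟨i₀, hi₀⟩ := hA.cover r
  filter_upwards [hA.image, eventually_ge_atTop i₀] with i hi hle S hS
  have h := hi r (hA.strictMono.monotone hle hi₀) _ hS
  have heq : {n | ∃ m ∈ Denumerable.ofNat ι ⁻¹' S, code m n ∈ r} =
      Denumerable.ofNat κ ⁻¹' {b | ∃ a ∈ S, R a b} := by
    ext n
    constructor
    · rintro ⟨m, hm, m', n', hc, hR⟩
      obtain ⟨rfl, rfl⟩ := code_inj hc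
      exact ⟨_, hm, hR⟩
    · rintro ⟨a, ha, hR⟩
      refine ⟨Encodable.encode a, by simpa using ha, _, n, rfl, by simpa using hR⟩
  rw [Coded, ← heq]
  exact h

end Filtration

/-! ### Sets of natural numbers and real numbers -/

open Classical in
/-- The point of the Cantor set whose ternary digits are given by `S`. -/
noncomputable def cantorPoint (S : Set ℕ) : ℝ :=
  Cardinal.cantorFunction (1 / 3) fun n => decide (n ∈ S)

theorem cantorPoint_mono {S T : Set ℕ} (h : S ⊆ T) : cantorPoint S ≤ cantorPoint T :=
  Cardinal.cantorFunction_le (by norm_num) (by norm_num) fun n hn => by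
    simpa using h (by simpa using hn)

theorem cantorPoint_lt {S T : Set ℕ} {n : ℕ} (h : ∀ k < n, k ∈ S ↔ k ∈ T) (hS : n ∉ S)
    (hT : n ∈ T) : cantorPoint S < cantorPoint T :=
  Cardinal.increasing_cantorFunction (by norm_num) (by norm_num) (n := n)
    (fun k hk => by simp [h k hk]) (by simpa using hS) (by simpa using hT)

theorem exists_finset_lt_cantorPoint {S : Set ℕ} {y : ℝ} (h : y < cantorPoint S) :
    ∃ F : Finset ℕ, (F : Set ℕ) ⊆ S ∧ y < cantorPoint F := by
  classical
  have hsum : ∀ S : Set ℕ,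
      Summable (Cardinal.cantorFunctionAux (1 / 3) fun n => decide (n ∈ S)) :=
    fun S => Cardinal.summable_cantor_function _ (by norm_num) (by norm_num)
  obtain ⟨G, hG⟩ := ((hsum S).hasSum.eventually (lt_mem_nhds h)).exists
  refine ⟨G.filter (· ∈ S), fun k hk => (Finset.mem_filter.1 hk).2, hG.trans_le ?_⟩
  have hle := (hsum (G.filter (· ∈ S) : Finset ℕ)).sum_le_tsum G
    (fun _ _ => Cardinal.cantorFunctionAux_nonneg (by norm_num))
  refine le_trans (le_of_eq (Finset.sum_congr rfl fun k hk => ?_)) hle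
  exact Cardinal.cantorFunctionAux_eq (by simp [hk])

/-- The digit of `S` at `n` can be read off from the comparisons of `cantorPoint S` with
the points given by finite and by cofinite sets: the witness is the finite set
`S ∩ {0, …, n - 1}`. -/
theorem mem_iff_cantorPoint {S : Set ℕ} {n : ℕ} :
    n ∈ S ↔ ∃ F : Finset ℕ, (∀ k ∈ F, k < n) ∧ cantorPoint (insert n (F : Set ℕ)) ≤ cantorPoint S ∧
      cantorPoint S ≤ cantorPoint (F ∪ Set.Ici n) := by
  classical
  constructor
  · intro hn
    refine ⟨(Finset.range n).filter (· ∈ S), fun k hk => ?_, cantorPoint_mono ?_,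
      cantorPoint_mono ?_⟩
    · exact Finset.mem_range.1 (Finset.mem_filter.1 hk).1
    · refine Set.insert_subset hn fun k hk => (Finset.mem_filter.1 hk).2
    · intro k hk
      rcases lt_or_ge k n with h | h
      · exact Or.inl (by simp [h, hk])
      · exact Or.inr h
  · rintro ⟨F, hF, h1, h2⟩
    by_contra hn
    by_cases hd : ∃ k, k < n ∧ ¬ (k ∈ S ↔ k ∈ F)
    · -- at the first difference `k` of `S` and `F`, one of the two inequalities fails
      have hk := Nat.find_spec hd
      have hmin : ∀ j < Nat.find hd, (j ∈ S ↔ j ∈ F) := fun j hj => by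
        have := Nat.find_min hd hj
        by_contra h
        exact this ⟨hj.trans hk.1, h⟩
      set k := Nat.find hd
      by_cases hkS : k ∈ S
      · have hkF : k ∉ F := fun h => hk.2 (iff_of_true hkS h)
        refine absurd h2 (not_le.2 (cantorPoint_lt (n := k) (fun j hj => ?_) ?_ hkS))
        · simp [hmin j hj, hj.trans hk.1]
        · simp [hkF, hk.1]
      · have hkF : k ∈ F := by
          by_contra h
          exact hk.2 (iff_of_false hkS h)
        refine absurd h1 (not_le.2 (cantorPoint_lt (n := k) (fun j hj => ?_) hkS ?_))
        · simp [hmin j hj, (hj.trans hk.1).ne]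
        · simp [hkF]
    · push Not at hd
      refine absurd h1 (not_le.2 (cantorPoint_lt (n := n) (fun j hj => ?_) hn (by simp)))
      simp [hd j hj, hj.ne]

/-- The cut of `cantorPoint S` is obtained from `S` by complements and images. -/
theorem cut_cantorPoint (S : Set ℕ) :
    cut (cantorPoint S) =
      {q : ℚ | ∃ F ∈ {F : Finset ℕ | ∃ m ∈ Sᶜ, m ∈ F}ᶜ, (q : ℝ) < cantorPoint F} := by
  ext q
  constructor
  · intro hq
    obtain ⟨F, hFS, hF⟩ := exists_finset_lt_cantorPoint hq
    refine ⟨F, ?_, hF⟩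
    rintro ⟨m, hm, hmF⟩
    exact hm (hFS hmF)
  · rintro ⟨F, hF, hq⟩
    refine hq.trans_le (cantorPoint_mono fun m hm => ?_)
    by_contra hmS
    exact hF ⟨m, hmS, hm⟩

theorem le_iff_compl_cut {x y : ℝ} : y ≤ x ↔ ¬ ∃ q ∈ (cut x)ᶜ, (q : ℝ) < y := by
  constructor
  · rintro h ⟨q, hq, hqy⟩
    exact hq (hqy.trans_le h)
  · intro h
    by_contra hxy
    obtain ⟨q, hxq, hqy⟩ := exists_rat_btwn (not_le.1 hxy)
    exact h ⟨q, not_lt.2 hxq.le, hqy⟩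

theorem le_iff_cut {x y : ℝ} : x ≤ y ↔ ¬ ∃ q ∈ cut x, y < (q : ℝ) := by
  constructor
  · rintro h ⟨q, hq, hqy⟩
    exact lt_asymm hqy (lt_of_lt_of_le hq h)
  · intro h
    by_contra hxy
    obtain ⟨q, hxq, hqy⟩ := exists_rat_btwn (not_le.1 hxy)
    exact h ⟨q, hqy, hxq⟩

/-- `S` is obtained from the cut of `cantorPoint S` by complements, images and an intersection. -/
theorem eq_of_cut_cantorPoint (S : Set ℕ) :
    S = {n | ∃ p ∈ {p : Finset ℕ × ℕ | ∃ q ∈ (cut (cantorPoint S))ᶜ,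
            (q : ℝ) < cantorPoint (insert p.2 (p.1 : Set ℕ))}ᶜ ∩
          {p : Finset ℕ × ℕ | ∃ q ∈ cut (cantorPoint S),
            cantorPoint (p.1 ∪ Set.Ici p.2) < (q : ℝ)}ᶜ, p.2 = n ∧ ∀ k ∈ p.1, k < n} := by
  ext n
  rw [mem_iff_cantorPoint]
  constructor
  · rintro ⟨F, hF, h1, h2⟩
    exact ⟨(F, n), ⟨le_iff_compl_cut.1 h1, le_iff_cut.1 h2⟩, rfl, hF⟩
  · rintro ⟨⟨F, m⟩, ⟨h1, h2⟩, rfl, hF⟩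
    exact ⟨F, hF, le_iff_compl_cut.2 h1, le_iff_cut.2 h2⟩

namespace Filtration

variable {I : Type*} [LinearOrder I] {A : I → Set (Set ℕ)}

theorem coded_cut_cantorPoint_iff (hA : Filtration A) :
    ∀ᶠ i in atTop, ∀ S : Set ℕ, S ∈ A i ↔ Coded (A i) (cut (cantorPoint S)) := by
  filter_upwards [hA.codedCompl (ι := ℕ), hA.codedCompl (ι := Finset ℕ), hA.codedCompl (ι := ℚ),
    hA.codedCompl (ι := Finset ℕ × ℕ), hA.codedInter (ι := Finset ℕ × ℕ),
    hA.codedImage fun (m : ℕ) (F : Finset ℕ) => m ∈ F,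
    hA.codedImage fun (F : Finset ℕ) (q : ℚ) => (q : ℝ) < cantorPoint F,
    hA.codedImage fun (q : ℚ) (p : Finset ℕ × ℕ) =>
      (q : ℝ) < cantorPoint (insert p.2 (p.1 : Set ℕ)),
    hA.codedImage fun (q : ℚ) (p : Finset ℕ × ℕ) => cantorPoint (p.1 ∪ Set.Ici p.2) < (q : ℝ),
    hA.codedImage fun (p : Finset ℕ × ℕ) (n : ℕ) => p.2 = n ∧ ∀ k ∈ p.1, k < n]
    with i c1 c2 c3 c4 i4 r1 r2 r3 r4 r5 S
  have hS : S ∈ A i ↔ Coded (A i) S := by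
    have h : Denumerable.ofNat ℕ ⁻¹' S = S := by
      ext n
      simp
    rw [Coded, h]
  rw [hS]
  constructor
  · intro h
    rw [cut_cantorPoint]
    exact r2 _ (c2 _ (r1 _ (c1 _ h)))
  · intro h
    rw [eq_of_cut_cantorPoint S]
    exact r5 _ (i4 _ _ (c4 _ (r3 _ (c3 _ h))) (c4 _ (r4 _ h)))

theorem coded_cut_add (hA : Filtration A) (s : ℚ) :
    ∀ᶠ i in atTop, ∀ x : ℝ, Coded (A i) (cut x) → Coded (A i) (cut (x + s)) := by
  filter_upwards [hA.codedImage fun p q : ℚ => q = p + s] with i hi x hx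
  have h := hi _ hx
  have heq : {q | ∃ p ∈ cut x, q = p + s} = cut (x + s) := by
    ext q
    constructor
    · rintro ⟨p, hp, rfl⟩
      change ((p + s : ℚ) : ℝ) < x + s
      push_cast
      exact add_lt_add_left hp _
    · intro hq
      refine ⟨q - s, ?_, by ring⟩
      change ((q - s : ℚ) : ℝ) < x
      push_cast
      exact sub_lt_iff_lt_add.2 hq
  exact heq ▸ h

/-- Late stages of a filtration define new reals in every interval. -/
theorem exists_new_real (hA : Filtration A) [Nonempty I] [SuccOrder I] [NoMaxOrder I]
    [CountableInterFilter (atTop : Filter I)] :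
    ∀ᶠ i in atTop, ∀ a b : ℝ, a < b → ∃ x ∈ Set.Ioo a b,
      Coded (A (Order.succ i)) (cut x) ∧ ¬ Coded (A i) (cut x) := by
  have hT : ∀ᶠ i in atTop, ∀ s : ℚ, ∀ x : ℝ, Coded (A i) (cut x) → Coded (A i) (cut (x + s)) :=
    eventually_countable_forall.2 hA.coded_cut_add
  obtain ⟨i₀, h₀⟩ := eventually_atTop.1 (hA.coded_cut_cantorPoint_iff.and hT)
  filter_upwards [eventually_ge_atTop i₀] with i hi a b hab
  obtain ⟨hC, hT⟩ := h₀ i hi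
  obtain ⟨hC', hT'⟩ := h₀ _ (hi.trans (Order.le_succ i))
  obtain ⟨S, hS, hSi⟩ := Set.exists_of_ssubset (hA.strictMono (Order.lt_succ i))
  obtain ⟨s, hs⟩ := exists_rat_btwn (sub_lt_sub_right hab (cantorPoint S))
  refine ⟨cantorPoint S + s, ⟨by linarith [hs.1], by linarith [hs.2]⟩,
    hT' s _ ((hC' S).1 hS), fun h => hSi ((hC S).2 ?_)⟩
  have h' := hT (-s) _ h
  rwa [Rat.cast_neg, add_neg_cancel_right] at h'

/-- The lower cut of `f x` is the image of the lower cut of `x` under a relation between rationals,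
so that each order-automorphism of a dense set is coded at some stage. -/
theorem coded_cut_orderIso (hA : Filtration A) {X : Set ℝ}
    (hX : ∀ a b : ℝ, a < b → ∃ w ∈ X, a < w ∧ w < b) (f : X ≃o X) :
    ∀ᶠ i in atTop, ∀ x : X, Coded (A i) (cut x) → Coded (A i) (cut (f x)) := by
  filter_upwards [hA.codedImage fun p q : ℚ => ∃ u : X, (u : ℝ) ≤ p ∧ (q : ℝ) < f u] with i hi x hx
  have h := hi _ hx
  have heq : {q : ℚ | ∃ p ∈ cut x, ∃ u : X, (u : ℝ) ≤ p ∧ (q : ℝ) < f u} = cut (f x) := by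
    ext q
    constructor
    · rintro ⟨p, hp, u, hup, hqu⟩
      have hux : u < x := Subtype.coe_lt_coe.1 (lt_of_le_of_lt hup hp)
      exact hqu.trans (Subtype.coe_lt_coe.2 (f.lt_iff_lt.2 hux))
    · intro hq
      obtain ⟨w, hw, hqw, hwx⟩ := hX _ _ hq
      have hux : f.symm ⟨w, hw⟩ < x := by
        rw [← f.lt_iff_lt, f.apply_symm_apply]
        exact Subtype.coe_lt_coe.1 hwx
      obtain ⟨p, hup, hpx⟩ := exists_rat_btwn (Subtype.coe_lt_coe.2 hux)
      exact ⟨p, hpx, _, hup.le, by rwa [f.apply_symm_apply]⟩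
  exact heq ▸ h

/-- If exactly one point `x j` of `X` appears at each late stage `j`, and tails of the enumeration
`x` are dense, then `X` is rigid: an automorphism that is coded at stage `i` has to fix each `x j`
with `i ≤ j`. -/
theorem rigid_range (hA : Filtration A) [Nonempty I] [SuccOrder I] [NoMaxOrder I] {i₀ : I}
    {x : Set.Ici i₀ → ℝ}
    (hx : ∀ j, Coded (A (Order.succ j.1)) (cut (x j)) ∧ ¬ Coded (A j) (cut (x j)))
    (hd : ∀ a b : ℝ, a < b → ∀ i, ∃ j : Set.Ici i₀, i ≤ j.1 ∧ a < x j ∧ x j < b) :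
    Rigid (Set.range x) := by
  intro f
  have hX : ∀ a b : ℝ, a < b → ∃ w ∈ Set.range x, a < w ∧ w < b := fun a b hab => by
    obtain ⟨j, -, hj⟩ := hd a b hab i₀
    exact ⟨x j, ⟨j, rfl⟩, hj⟩
  have hmono : ∀ {i j : I} {y : ℝ}, i ≤ j → Coded (A i) (cut y) → Coded (A j) (cut y) :=
    fun hij h => hA.strictMono.monotone hij h
  obtain ⟨i, hi⟩ := eventually_atTop.1
    ((hA.coded_cut_orderIso hX f).and (hA.coded_cut_orderIso hX f.symm))
  have hfix : ∀ j : Set.Ici i₀, i ≤ j.1 → f ⟨x j, j, rfl⟩ = ⟨x j, j, rfl⟩ := by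
    intro j hij
    obtain ⟨k, hk⟩ := (f ⟨x j, j, rfl⟩).2
    have hk' : f ⟨x j, j, rfl⟩ = ⟨x k, k, rfl⟩ := Subtype.ext hk.symm
    rcases lt_trichotomy j k with hjk | rfl | hjk
    · have h := (hi _ (hij.trans (Order.le_succ j.1))).1 ⟨x j, j, rfl⟩ (hx j).1
      rw [hk'] at h
      exact absurd (hmono (Order.succ_le_of_lt hjk) h) (hx k).2
    · exact hk'
    · have h := (hi _ hij).2 ⟨x k, k, rfl⟩ (hmono (Order.succ_le_of_lt hjk) (hx k).1)
      rw [← hk', f.symm_apply_apply] at h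
      exact absurd h (hx j).2
  ext y
  change (f y : ℝ) = y
  rcases lt_trichotomy (y : ℝ) (f y) with h | h | h
  · obtain ⟨j, hij, h1, h2⟩ := hd _ _ h i
    have hlt : f y < f ⟨x j, j, rfl⟩ := f.lt_iff_lt.2 (Subtype.coe_lt_coe.1 h1)
    rw [hfix j hij] at hlt
    exact absurd h2 (lt_asymm (Subtype.coe_lt_coe.2 hlt))
  · exact h.symm
  · obtain ⟨j, hij, h1, h2⟩ := hd _ _ h i
    have hlt : f ⟨x j, j, rfl⟩ < f y := f.lt_iff_lt.2 (Subtype.coe_lt_coe.1 h2)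
    rw [hfix j hij] at hlt
    exact absurd h1 (lt_asymm (Subtype.coe_lt_coe.2 hlt))

/-- A late stage `j` contributes one new real, taken from the rational interval `r j`. Each
interval is served uncountably often; since initial segments of `I` are countable, the chosen points
stay dense when a proper initial segment of the enumeration is dropped. -/
theorem exists_rigid {I : Type v} [LinearOrder I] {A : I → Set (Set ℕ)} (hA : Filtration A)
    [Nonempty I] [SuccOrder I] [NoMaxOrder I] [CountableInterFilter (atTop : Filter I)]
    (hI : #I = ℵ₁) (hc : ∀ i : I, (Set.Iio i).Countable) :
    ∃ X : Set ℝ, OmegaOneDense X ∧ Rigid X := by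
  obtain ⟨i₀, h₀⟩ := eventually_atTop.1 hA.exists_new_real
  -- `r` assigns a pair of rationals to each stage, and takes each value uncountably often.
  obtain ⟨r, hr⟩ : ∃ r : I → ℚ × ℚ, ∀ p, ¬ {i | r i = p}.Countable := by
    have hcard : #I = #(I × (ℚ × ℚ)) := by
      have h1 : ℵ₀ ≤ #I := hI ▸ Cardinal.aleph0_le_aleph 1
      simp [Cardinal.mul_eq_left h1 h1 Cardinal.aleph0_ne_zero]
    obtain ⟨e⟩ := Cardinal.eq.1 hcard
    refine ⟨fun i => (e i).2, fun p hp => ?_⟩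
    have hcount : (Set.univ : Set I).Countable := by
      refine (hp.image fun i => (e i).1).mono fun i _ => (Set.mem_image _ _ _).2 ?_
      exact ⟨e.symm (i, p), by simp, by simp⟩
    have h2 := Set.countable_univ_iff.1 hcount
    rw [← Cardinal.mk_le_aleph0_iff, hI] at h2
    exact absurd h2 (not_le.2 Cardinal.aleph0_lt_aleph_one)
  have hex : ∀ j : Set.Ici i₀, ∃ y : ℝ,
      (Coded (A (Order.succ j.1)) (cut y) ∧ ¬ Coded (A j) (cut y)) ∧
        ((r j).1 < (r j).2 → y ∈ Set.Ioo ((r j).1 : ℝ) (r j).2) := by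
    intro j
    by_cases hj : (r j).1 < (r j).2
    · obtain ⟨y, hy, hyj⟩ := h₀ j j.2 _ _ (Rat.cast_lt.2 hj)
      exact ⟨y, hyj, fun _ => hy⟩
    · obtain ⟨y, -, hyj⟩ := h₀ j j.2 0 1 one_pos
      exact ⟨y, hyj, fun h => absurd h hj⟩
  choose x hx hxr using hex
  have hlt : ∀ j k, j < k → x j ≠ x k := fun j k hjk h =>
    (hx k).2 (h ▸ hA.strictMono.monotone (Order.succ_le_of_lt (Subtype.coe_lt_coe.2 hjk)) (hx j).1)
  have hinj : Function.Injective x := fun j k h => by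
    rcases lt_trichotomy j k with hjk | hjk | hjk
    exacts [absurd h (hlt _ _ hjk), hjk, absurd h.symm (hlt _ _ hjk)]
  have hunc : ∀ a b : ℝ, a < b → ¬ {j | x j ∈ Set.Ioo a b}.Countable := by
    intro a b hab hcount
    obtain ⟨p, hap, hpb⟩ := exists_rat_btwn hab
    obtain ⟨q, hpq, hqb⟩ := exists_rat_btwn hpb
    refine hr (p, q) (((hc i₀).union (hcount.image Subtype.val)).mono fun i hi => ?_)
    rcases lt_or_ge i i₀ with h | h
    · exact Or.inl h
    · have hi' : r i = (p, q) := hi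
      have hxi := hxr ⟨i, h⟩
      simp only [hi'] at hxi
      have := hxi (Rat.cast_lt.1 hpq)
      exact Or.inr ⟨⟨i, h⟩, ⟨hap.trans this.1, this.2.trans hqb⟩, rfl⟩
  refine ⟨Set.range x, fun a b hab => le_antisymm ?_ ?_, hA.rigid_range hx fun a b hab i => ?_⟩
  · have h1 : Cardinal.lift.{v} #(Set.range x) ≤ Cardinal.lift.{0} #(Set.Ici i₀) :=
      Cardinal.mk_range_le_lift
    have h2 : Cardinal.lift.{v} #(Set.range x) ≤ Cardinal.lift.{v} (ℵ₁ : Cardinal.{0}) := by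
      refine h1.trans ?_
      rw [Cardinal.lift_id'.{0, v}]
      refine (Cardinal.mk_set_le _).trans ?_
      rw [hI]
      simp
    exact (Cardinal.mk_le_mk_of_subset Set.inter_subset_left).trans (Cardinal.lift_le.1 h2)
  · rw [← not_lt]
    intro h
    refine hunc a b hab ?_
    have hcount : (Set.range x ∩ Set.Ioo a b).Countable := by
      rwa [← Cardinal.succ_aleph0, Order.lt_succ_iff, Cardinal.le_aleph0_iff_set_countable] at h
    refine (hcount.preimage hinj).mono fun j hj => ?_
    exact ⟨Set.mem_range_self j, hj⟩
  · by_contra! h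
    refine hunc a b hab (((hc i).preimage Subtype.val_injective).mono fun j hj => ?_)
    exact not_le.1 fun hij => absurd hj.2 (not_lt.2 (h j hij hj.1))

end Filtration

/-! ### From a slicing sequence to a filtration -/

theorem mk_Iio_omega_one : #(Set.Iio (ω₁ : Ordinal.{u})) = ℵ₁ := by
  rw [Cardinal.mk_Iio_ordinal]
  simp

theorem countable_Iio_omega_one (i : Set.Iio (ω₁ : Ordinal.{u})) : (Set.Iio i).Countable := by
  have hmaps : Set.MapsTo Subtype.val (Set.Iio i) (Set.Iio i.1) := fun _ h => h
  refine hmaps.countable_of_injOn Subtype.val_injective.injOn ?_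
  have hi : i.1.card < ℵ₁ := by
    rw [← Cardinal.lt_ord, Cardinal.ord_aleph]
    exact i.2
  rw [← Cardinal.succ_aleph0, Order.lt_succ_iff] at hi
  rw [← Cardinal.le_aleph0_iff_set_countable, Cardinal.mk_Iio_ordinal]
  rw [← Cardinal.lift_aleph0.{u + 1, u}, Cardinal.lift_le]
  exact hi

instance : Nonempty (Set.Iio (ω₁ : Ordinal.{u})) := ⟨⟨0, Ordinal.omega_pos 1⟩⟩

instance : NoMaxOrder (Set.Iio (ω₁ : Ordinal.{u})) where
  exists_gt i := ⟨⟨Order.succ i.1, (Cardinal.isSuccLimit_omega 1).succ_lt i.2⟩, Order.lt_succ i.1⟩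

instance : CountableInterFilter (atTop : Filter (Set.Iio (ω₁ : Ordinal.{u}))) where
  countable_sInter_mem S hS hmem := by
    have := hS.to_subtype
    choose f hf using fun s : S => mem_atTop_sets.1 (hmem s s.2)
    refine mem_atTop_sets.2 ⟨⟨⨆ s, (f s).1, Ordinal.iSup_lt_omega_one fun s => (f s).2⟩, ?_⟩
    intro i hi s hs
    have hbdd : BddAbove (Set.range fun s => (f s).1) := ⟨ω₁, by
      rintro _ ⟨s, rfl⟩
      exact (f s).2.le⟩
    exact hf ⟨s, hs⟩ i ((le_ciSup hbdd ⟨s, hs⟩).trans hi)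

theorem Slice.exists_filtration (h : Slice.{u} ℵ₁) :
    ∃ A : Set.Iio (ω₁ : Ordinal.{u}) → Set (Set ℕ), Filtration A := by
  obtain ⟨M, hT, hM, -, hcov, hss⟩ := h
  rw [Cardinal.ord_aleph] at hT hM hcov hss
  have hω := Ordinal.omega0_lt_omega_one.{u}
  have hcov' : ∀ S : Set ℕ, ∃ i : Set.Iio (ω₁ : Ordinal.{u}), chi S ∈ M i := by
    intro S
    have hS : chi S ∈ (twoPow (ω : Ordinal.{u}) : Set ZFSet.{u}) := chi_mem_twoPow S
    rw [hcov ω le_rfl hω] at hS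
    simp only [Set.mem_iUnion] at hS
    obtain ⟨i, hi, hS⟩ := hS
    exact ⟨⟨i, hi⟩, hS.2⟩
  have hmono : StrictMono fun i : Set.Iio (ω₁ : Ordinal.{u}) => {S | chi S ∈ M i} := by
    intro i j hij
    have hs := hss i j hij j.2 ω le_rfl hω
    refine Set.ssubset_iff_exists.2 ⟨fun S hS => (hs.1 ⟨chi_mem_twoPow S, hS⟩).2, ?_⟩
    obtain ⟨y, hy, hyi⟩ := Set.exists_of_ssubset hs
    obtain ⟨S, rfl⟩ := exists_eq_chi hy.1
    exact ⟨S, hy.2, fun h => hyi ⟨hy.1, h⟩⟩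
  have hconst : ∀ S : Set ℕ, ∀ᶠ i : Set.Iio (ω₁ : Ordinal.{u}) in atTop, chi S ∈ M i := by
    intro S
    obtain ⟨i, hi⟩ := hcov' S
    filter_upwards [eventually_ge_atTop i] with j hj
    exact hmono.monotone hj hi
  refine ⟨_, hmono, hcov', ?_, ?_, ?_⟩ <;>
    filter_upwards [hconst ∅, hconst Set.univ] with i h0 h1
  · exact fun S hS => chi_compl_mem_model (hM i i.2) (hT i i.2) h0 h1 hS
  · exact fun S hS T hT' => chi_inter_mem_model (hM i i.2) (hT i i.2) h0 h1 hS hT'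
  · exact fun R hR S hS => chi_image_mem_model (hM i i.2) (hT i i.2) h0 h1 hR hS

end Slicing

theorem mainTheorem4 (h : Slicing.Slice.{u} ℵ₁) :
    ∃ X : Set ℝ, Slicing.OmegaOneDense X ∧ Slicing.Rigid X := by
  obtain ⟨A, hA⟩ := h.exists_filtration
  let _ : SuccOrder (Set.Iio (ω₁ : Ordinal.{u})) := SuccOrder.ofLinearWellFoundedLT _
  exact hA.exists_rigid Slicing.mk_Iio_omega_one Slicing.countable_Iio_omega_one
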